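/- Let $(M,g)$ be a smooth, connected, Hausdorff pseudo-Riemannian manifold (any signature) of dimension $n\ge 4$, with Levi-Civita connection $\nabla$, and Riemann tensor $R_{jkl}{}^m$ normalised by $(\nabla_j\nabla_k-\nabla_k\nabla_j)v_l=R_{jkl}{}^m v_m$. Let $R_{kl}=-R_{mkl}{}^m$ be the Ricci tensor, $R=g^{ij}R_{ij}$ the curvature scalar, and $$C_{jkl}{}^m=R_{jkl}{}^m+\frac{1}{n-2}\left(\delta_j{}^mR_{kl}-\delta_k{}^mR_{jl}+R_j{}^mg_{kl}-R_k{}^mg_{jl}\right)-R\,\frac{\delta_j{}^mg_{kl}-\delta_k{}^mg_{jl}}{(n-1)(n-2)}$$ the Weyl tensor. Assume that $(M,g)$ is conformally recurrent, i.e. there is a smooth covector field $\alpha_i$, not identically zero, with $\nabla_iC_{jklm}=\alpha_iC_{jklm}$, and that the scalar $C^2=C_{jklm}C^{jklm}$ vanishes nowhere on $M$. Then the tensor $$h_{ij}=\frac{1}{C^2}\,C_i{}^{klm}C_{jklm}$$ is covariantly constant, $\nabla_kh_{ij}=0$; it is Riemann compatible, $$h_{im}R_{jkl}{}^m+h_{jm}R_{kil}{}^m+h_{km}R_{ijl}{}^m=0;$$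 it is Weyl compatible, $$h_{im}C_{jkl}{}^m+h_{jm}C_{kil}{}^m+h_{km}C_{ijl}{}^m=0;$$ and it commutes with the Ricci tensor, $h_{im}R_k{}^m=R_i{}^mh_{km}$. -/

import Mathlib

open scoped Manifold ContDiff Bundle

noncomputable section

/-! ### Pseudo-Riemannian metrics on a smooth manifold -/

/-- A smooth pseudo-Riemannian metric on an `n`-dimensional smooth manifold `M`: a smooth field of
symmetric nondegenerate bilinear forms on the tangent spaces, of arbitrary signature. -/
structure PseudoRiemannianMetric (n : ℕ) (M : Type*) [TopologicalSpace M]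
    [ChartedSpace (EuclideanSpace ℝ (Fin n)) M] [IsManifold (𝓡 n) ∞ M] where
  /-- the bilinear form on each tangent space -/
  inner (x : M) : TangentSpace (𝓡 n) x →L[ℝ] TangentSpace (𝓡 n) x →L[ℝ] ℝ
  symm (x : M) (v w : TangentSpace (𝓡 n) x) : inner x v w = inner x w v
  nondegenerate (x : M) (v : TangentSpace (𝓡 n) x) (hv : ∀ w, inner x v w = 0) : v = 0
  contMDiff : ContMDiff (𝓡 n)
    ((𝓡 n).prod 𝓘(ℝ, EuclideanSpace ℝ (Fin n) →L[ℝ] EuclideanSpace ℝ (Fin n) →L[ℝ] ℝ)) ∞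
    (fun x : M ↦ Bundle.TotalSpace.mk'
      (E := fun x : M ↦ TangentSpace (𝓡 n) x →L[ℝ] TangentSpace (𝓡 n) x →L[ℝ] ℝ)
      (EuclideanSpace ℝ (Fin n) →L[ℝ] EuclideanSpace ℝ (Fin n) →L[ℝ] ℝ) x (inner x))

/-- A smooth covector field (one-form) on `M`. -/
structure CovectorField (n : ℕ) (M : Type*) [TopologicalSpace M]
    [ChartedSpace (EuclideanSpace ℝ (Fin n)) M] [IsManifold (𝓡 n) ∞ M] where
  /-- the covector at each point -/
  toFun (x : M) : TangentSpace (𝓡 n) x →L[ℝ] ℝ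
  contMDiff : ContMDiff (𝓡 n) ((𝓡 n).prod 𝓘(ℝ, EuclideanSpace ℝ (Fin n) →L[ℝ] ℝ)) ∞
    (fun x : M ↦ Bundle.TotalSpace.mk' (E := fun x : M ↦ TangentSpace (𝓡 n) x →L[ℝ] ℝ)
      (EuclideanSpace ℝ (Fin n) →L[ℝ] ℝ) x (toFun x))

/-! ### Tensor calculus in coordinates

`g : EuclideanSpace ℝ (Fin n) → Matrix (Fin n) (Fin n) ℝ` is the matrix of components of a metric
in some chart, as a function of the coordinates. -/

namespace Coord

variable {n : ℕ}

/-- The partial derivative `∂_i f` at the point `y`. -/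
def pd (i : Fin n) (f : EuclideanSpace ℝ (Fin n) → ℝ) (y : EuclideanSpace ℝ (Fin n)) : ℝ :=
  fderiv ℝ f y (EuclideanSpace.single i 1)

/-- The Christoffel symbol `Γ^m_{ij}` of the Levi-Civita connection. -/
def christoffel (g : EuclideanSpace ℝ (Fin n) → Matrix (Fin n) (Fin n) ℝ)
    (m i j : Fin n) (y : EuclideanSpace ℝ (Fin n)) : ℝ :=
  (1 / 2) * ∑ p, (g y)⁻¹ m p *
    (pd i (fun z ↦ g z p j) y + pd j (fun z ↦ g z p i) y - pd p (fun z ↦ g z i j) y)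

/-- The Riemann tensor `R_{jkl}{}^m`, with the sign convention
`(∇_j ∇_k - ∇_k ∇_j) v_l = R_{jkl}{}^m v_m`. -/
def riemann (g : EuclideanSpace ℝ (Fin n) → Matrix (Fin n) (Fin n) ℝ)
    (y : EuclideanSpace ℝ (Fin n)) (j k l m : Fin n) : ℝ :=
  pd k (christoffel g m j l) y - pd j (christoffel g m k l) y
    + ∑ p, (christoffel g m k p y * christoffel g p j l y
        - christoffel g m j p y * christoffel g p k l y)

/-- The Ricci tensor `R_{kl} = -R_{mkl}{}^m`. -/
def ricci (g : EuclideanSpace ℝ (Fin n) → Matrix (Fin n) (Fin n) ℝ)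
    (y : EuclideanSpace ℝ (Fin n)) (k l : Fin n) : ℝ :=
  -∑ m, riemann g y m k l m

/-- The Ricci tensor with the second index raised, `R_k{}^m = R_{kl} g^{lm}`. -/
def ricciUp (g : EuclideanSpace ℝ (Fin n) → Matrix (Fin n) (Fin n) ℝ)
    (y : EuclideanSpace ℝ (Fin n)) (k m : Fin n) : ℝ :=
  ∑ l, ricci g y k l * (g y)⁻¹ l m

/-- The curvature scalar `R = g^{ij} R_{ij}`. -/
def scalarCurv (g : EuclideanSpace ℝ (Fin n) → Matrix (Fin n) (Fin n) ℝ)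
    (y : EuclideanSpace ℝ (Fin n)) : ℝ :=
  ∑ i, ∑ j, (g y)⁻¹ i j * ricci g y i j

/-- The Kronecker symbol `δ_j{}^m`. -/
def kron (j m : Fin n) : ℝ := if j = m then 1 else 0

/-- The conformal curvature (Weyl) tensor `C_{jkl}{}^m`. -/
def weyl (g : EuclideanSpace ℝ (Fin n) → Matrix (Fin n) (Fin n) ℝ)
    (y : EuclideanSpace ℝ (Fin n)) (j k l m : Fin n) : ℝ :=
  riemann g y j k l m
    + (1 / ((n : ℝ) - 2)) * (kron j m * ricci g y k l - kron k m * ricci g y j l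
        + ricciUp g y j m * g y k l - ricciUp g y k m * g y j l)
    - scalarCurv g y * (kron j m * g y k l - kron k m * g y j l)
        / (((n : ℝ) - 1) * ((n : ℝ) - 2))

/-- The covariant Weyl tensor `C_{jklm} = C_{jkl}{}^p g_{pm}`. -/
def weylLow (g : EuclideanSpace ℝ (Fin n) → Matrix (Fin n) (Fin n) ℝ)
    (y : EuclideanSpace ℝ (Fin n)) (j k l m : Fin n) : ℝ :=
  ∑ p, weyl g y j k l p * g y p m

/-- The Weyl tensor with its last three indices raised, `C_i{}^{klm}`. -/
def weylUp (g : EuclideanSpace ℝ (Fin n) → Matrix (Fin n) (Fin n) ℝ)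
    (y : EuclideanSpace ℝ (Fin n)) (i k l m : Fin n) : ℝ :=
  ∑ p, ∑ q, ∑ r, (g y)⁻¹ k p * (g y)⁻¹ l q * (g y)⁻¹ m r * weylLow g y i p q r

/-- The contraction `C_i{}^{klm} C_{jklm}`. -/
def weylContr (g : EuclideanSpace ℝ (Fin n) → Matrix (Fin n) (Fin n) ℝ)
    (y : EuclideanSpace ℝ (Fin n)) (i j : Fin n) : ℝ :=
  ∑ k, ∑ l, ∑ m, weylUp g y i k l m * weylLow g y j k l m

/-- The scalar `C² = C_{jklm} C^{jklm}`. -/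
def weylSq (g : EuclideanSpace ℝ (Fin n) → Matrix (Fin n) (Fin n) ℝ)
    (y : EuclideanSpace ℝ (Fin n)) : ℝ :=
  ∑ i, ∑ j, (g y)⁻¹ i j * weylContr g y i j

/-- The tensor `h_{ij} = C_i{}^{klm} C_{jklm} / C²`. -/
def hTensor (g : EuclideanSpace ℝ (Fin n) → Matrix (Fin n) (Fin n) ℝ)
    (y : EuclideanSpace ℝ (Fin n)) (i j : Fin n) : ℝ :=
  weylContr g y i j / weylSq g y

/-- The covariant derivative `∇_k b_{ij}` of a tensor field with two lower indices. -/
def covDeriv₂ (g : EuclideanSpace ℝ (Fin n) → Matrix (Fin n) (Fin n) ℝ)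
    (b : EuclideanSpace ℝ (Fin n) → Fin n → Fin n → ℝ)
    (y : EuclideanSpace ℝ (Fin n)) (k i j : Fin n) : ℝ :=
  pd k (fun z ↦ b z i j) y
    - ∑ p, (christoffel g p k i y * b y p j + christoffel g p k j y * b y i p)

/-- The covariant derivative `∇_i T_{jklm}` of a tensor field with four lower indices. -/
def covDeriv₄ (g : EuclideanSpace ℝ (Fin n) → Matrix (Fin n) (Fin n) ℝ)
    (T : EuclideanSpace ℝ (Fin n) → Fin n → Fin n → Fin n → Fin n → ℝ)
    (y : EuclideanSpace ℝ (Fin n)) (i j k l m : Fin n) : ℝ :=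
  pd i (fun z ↦ T z j k l m) y
    - ∑ p, (christoffel g p i j y * T y p k l m + christoffel g p i k y * T y j p l m
        + christoffel g p i l y * T y j k p m + christoffel g p i m y * T y j k l p)

/-- The field `b_{ij}` is covariantly constant at `y`: its components are differentiable there
and `∇_k b_{ij} = 0`. -/
def IsCovConstAt (g : EuclideanSpace ℝ (Fin n) → Matrix (Fin n) (Fin n) ℝ)
    (b : EuclideanSpace ℝ (Fin n) → Fin n → Fin n → ℝ) (y : EuclideanSpace ℝ (Fin n)) : Prop :=
  (∀ i j, DifferentiableAt ℝ (fun z ↦ b z i j) y) ∧ ∀ k i j, covDeriv₂ g b y k i j = 0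

/-- `b_{ij}` is `K`-compatible, for `K_{jkl}{}^m` a curvature tensor:
`b_{im} K_{jkl}{}^m + b_{jm} K_{kil}{}^m + b_{km} K_{ijl}{}^m = 0`. -/
def IsCompatible (K : Fin n → Fin n → Fin n → Fin n → ℝ) (b : Fin n → Fin n → ℝ) : Prop :=
  ∀ i j k l, ∑ m, (b i m * K j k l m + b j m * K k i l m + b k m * K i j l m) = 0

/-- `b_{ij}` commutes with the Ricci tensor: `b_{im} R_k{}^m = R_i{}^m b_{km}`. -/
def CommutesWithRicciAt (g : EuclideanSpace ℝ (Fin n) → Matrix (Fin n) (Fin n) ℝ)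
    (b : Fin n → Fin n → ℝ) (y : EuclideanSpace ℝ (Fin n)) : Prop :=
  ∀ i k, ∑ m, b i m * ricciUp g y k m = ∑ m, ricciUp g y i m * b k m

end Coord

/-! ### Components in the charts of a manifold -/

section Components

variable {n : ℕ} {M : Type*} [TopologicalSpace M] [ChartedSpace (EuclideanSpace ℝ (Fin n)) M]

/-- The coordinate vector field `∂_i` of the chart `e`, at the point with coordinates `y`. -/
def coordVector (e : OpenPartialHomeomorph M (EuclideanSpace ℝ (Fin n))) (i : Fin n)
    (y : EuclideanSpace ℝ (Fin n)) : TangentSpace (𝓡 n) (e.symm y) :=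
  mfderiv (𝓡 n) (𝓡 n) e.symm y (EuclideanSpace.single i (1 : ℝ) : EuclideanSpace ℝ (Fin n))

variable [IsManifold (𝓡 n) ∞ M]

/-- The components `g_{ij} = g(∂_i, ∂_j)` of the metric in the chart `e`. -/
def PseudoRiemannianMetric.comp (g : PseudoRiemannianMetric n M)
    (e : OpenPartialHomeomorph M (EuclideanSpace ℝ (Fin n))) (y : EuclideanSpace ℝ (Fin n)) :
    Matrix (Fin n) (Fin n) ℝ :=
  Matrix.of fun i j ↦ g.inner (e.symm y) (coordVector e i y) (coordVector e j y)

/-- The components `α_i = α(∂_i)` of a covector field in the chart `e`. -/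
def CovectorField.comp (α : CovectorField n M)
    (e : OpenPartialHomeomorph M (EuclideanSpace ℝ (Fin n))) (y : EuclideanSpace ℝ (Fin n))
    (i : Fin n) : ℝ :=
  α.toFun (e.symm y) (coordVector e i y)

/-- `(M, g)` is conformally recurrent: there is a covector field `α`, not identically zero, with
`∇_i C_{jklm} = α_i C_{jklm}` (in all local coordinates of the smooth structure). -/
def PseudoRiemannianMetric.IsConformallyRecurrent (g : PseudoRiemannianMetric n M) : Prop :=
  ∃ α : CovectorField n M, (∃ x, α.toFun x ≠ 0) ∧
    ∀ e ∈ IsManifold.maximalAtlas (𝓡 n) ∞ M, ∀ y ∈ e.target, ∀ i j k l m,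
      Coord.covDeriv₄ (g.comp e) (Coord.weylLow (g.comp e)) y i j k l m
        = α.comp e y i * Coord.weylLow (g.comp e) y j k l m

/-- `C² = C_{jklm} C^{jklm}` vanishes at no point of `M`. -/
def PseudoRiemannianMetric.WeylSqNeZero (g : PseudoRiemannianMetric n M) : Prop :=
  ∀ e ∈ IsManifold.maximalAtlas (𝓡 n) ∞ M, ∀ y ∈ e.target, Coord.weylSq (g.comp e) y ≠ 0

end Components

end

/-! Write `W` for the contraction `C_i{}^{klm} C_{jklm}`. Contracting with the parallel inverse
metric, the recurrence gives `∇_c W = 2 α_c W` and `∇_c C² = 2 α_c C²`; the equal factors cancel in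
the quotient, so `h = W / C²` is parallel (`pd_weylContr`, `pd_weylSq`, `pd_hTensor`).

The rest holds for any symmetric parallel tensor. The commutator of two covariant derivatives kills
`h`, so `h_{im} R_{jkl}{}^m + h_{lm} R_{jki}{}^m = 0` (`curvMat_mul_add_mul_transpose_eq_zero`).
Summing cyclically over `i, j, k` and using the first Bianchi identity gives Riemann compatibility
(`isCompatible_riemann`). Its contraction with `g^{jl}` gives commutation with Ricci
(`commutesWithRicciAt`). These two facts make the Ricci and scalar terms of the Weyl tensor drop out
of its compatibility condition (`isCompatible_weyl`).

All of this happens for a matrix-valued function `g` on an open set of coordinates;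
`isSmoothMetricOn_comp` supplies such a function in each chart. -/

noncomputable section

namespace Coord

variable {n : ℕ}

/-! ### Partial derivatives -/

section PartialDerivatives

variable {f h : EuclideanSpace ℝ (Fin n) → ℝ} {y : EuclideanSpace ℝ (Fin n)}
  {U : Set (EuclideanSpace ℝ (Fin n))}

lemma pd_congr (c : Fin n) (hfh : f =ᶠ[nhds y] h) : pd c f y = pd c h y := by
  simp only [pd, hfh.fderiv_eq]

lemma pd_const (c : Fin n) (a : ℝ) : pd c (fun _ ↦ a) y = 0 := by
  simp [pd]

lemma pd_add (c : Fin n) (hf : DifferentiableAt ℝ f y) (hh : DifferentiableAt ℝ h y) :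
    pd c (fun z ↦ f z + h z) y = pd c f y + pd c h y := by
  simp [pd, fderiv_fun_add hf hh]

lemma pd_mul (c : Fin n) (hf : DifferentiableAt ℝ f y) (hh : DifferentiableAt ℝ h y) :
    pd c (fun z ↦ f z * h z) y = pd c f y * h y + f y * pd c h y := by
  simp [pd, fderiv_fun_mul hf hh]
  ring

lemma pd_div (c : Fin n) (hf : DifferentiableAt ℝ f y) (hh : DifferentiableAt ℝ h y)
    (h0 : h y ≠ 0) :
    pd c (fun z ↦ f z / h z) y = (pd c f y * h y - f y * pd c h y) / h y ^ 2 := by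
  have hd : DifferentiableAt ℝ (fun z ↦ f z / h z) y := by
    simpa only [div_eq_mul_inv] using hf.fun_mul (hh.fun_inv h0)
  have hev : ∀ᶠ z in nhds y, h z ≠ 0 := hh.continuousAt.eventually_ne h0
  have key : pd c f y = pd c (fun z ↦ f z / h z * h z) y :=
    pd_congr c (hev.mono fun z hz ↦ (div_mul_cancel₀ _ hz).symm)
  rw [pd_mul c hd hh] at key
  rw [key]
  field_simp
  ring

lemma pd_sum {ι : Type*} (s : Finset ι) {F : ι → EuclideanSpace ℝ (Fin n) → ℝ} (c : Fin n)
    (hF : ∀ i ∈ s, DifferentiableAt ℝ (F i) y) :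
    pd c (fun z ↦ ∑ i ∈ s, F i z) y = ∑ i ∈ s, pd c (F i) y := by
  simp [pd, fderiv_fun_sum hF]

lemma pd_comm (c d : Fin n) (hf : ContDiffAt ℝ ∞ f y) :
    pd c (pd d f) y = pd d (pd c f) y := by
  have hsymm : IsSymmSndFDerivAt ℝ f y := hf.isSymmSndFDerivAt
    (by simpa using (ENat.LEInfty.out : (2 : WithTop ℕ∞) ≤ ∞))
  have hd : DifferentiableAt ℝ (fderiv ℝ f) y :=
    (hf.fderiv_right (m := 1)
      (by simpa [one_add_one_eq_two] using (ENat.LEInfty.out : (2 : WithTop ℕ∞) ≤ ∞))).differentiableAt (by simp)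
  have key (a b : Fin n) : pd a (pd b f) y =
      fderiv ℝ (fderiv ℝ f) y (EuclideanSpace.single a 1) (EuclideanSpace.single b 1) := by
    change fderiv ℝ (fun z ↦ fderiv ℝ f z (EuclideanSpace.single b 1)) y _ = _
    rw [fderiv_clm_apply hd (differentiableAt_const _)]
    simp
  rw [key, key, hsymm]

lemma contDiffOn_pd (c : Fin n) (hU : IsOpen U) (hf : ContDiffOn ℝ ∞ f U) :
    ContDiffOn ℝ ∞ (pd c f) U :=
  (hf.fderiv_of_isOpen hU (by simp)).clm_apply contDiffOn_const

end PartialDerivatives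

/-! ### Matrices of functions -/

section MatrixFields

/-- The entrywise partial derivative of a matrix of functions. -/
def pdMat (c : Fin n) (F : EuclideanSpace ℝ (Fin n) → Matrix (Fin n) (Fin n) ℝ)
    (y : EuclideanSpace ℝ (Fin n)) : Matrix (Fin n) (Fin n) ℝ :=
  Matrix.of fun i j ↦ pd c (fun z ↦ F z i j) y

variable {F H : EuclideanSpace ℝ (Fin n) → Matrix (Fin n) (Fin n) ℝ}
  {y : EuclideanSpace ℝ (Fin n)} {U : Set (EuclideanSpace ℝ (Fin n))}

lemma pdMat_mul (c : Fin n) (hF : ∀ i j, DifferentiableAt ℝ (fun z ↦ F z i j) y)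
    (hH : ∀ i j, DifferentiableAt ℝ (fun z ↦ H z i j) y) :
    pdMat c (fun z ↦ F z * H z) y = pdMat c F y * H y + F y * pdMat c H y := by
  ext i j
  simp only [pdMat, Matrix.of_apply, Matrix.mul_apply, Matrix.add_apply,
    ← Finset.sum_add_distrib]
  rw [pd_sum _ _ fun p _ ↦ (hF i p).fun_mul (hH p j)]
  exact Finset.sum_congr rfl fun p _ ↦ pd_mul c (hF i p) (hH p j)

lemma pdMat_add (c : Fin n) (hF : ∀ i j, DifferentiableAt ℝ (fun z ↦ F z i j) y)
    (hH : ∀ i j, DifferentiableAt ℝ (fun z ↦ H z i j) y) :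
    pdMat c (fun z ↦ F z + H z) y = pdMat c F y + pdMat c H y := by
  ext i j
  exact pd_add c (hF i j) (hH i j)

lemma pdMat_congr (c : Fin n) (hFH : F =ᶠ[nhds y] H) : pdMat c F y = pdMat c H y := by
  ext i j
  exact pd_congr c (hFH.mono fun z hz ↦ congrFun₂ hz i j)

lemma pdMat_transpose (c : Fin n) : pdMat c (fun z ↦ (F z).transpose) y = (pdMat c F y).transpose :=
  rfl

lemma contDiffOn_det {ι : Type*} [Fintype ι] [DecidableEq ι]
    {F : EuclideanSpace ℝ (Fin n) → Matrix ι ι ℝ}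
    (hF : ∀ i j, ContDiffOn ℝ ∞ (fun z ↦ F z i j) U) :
    ContDiffOn ℝ ∞ (fun z ↦ (F z).det) U := by
  simp only [Matrix.det_apply']
  exact ContDiffOn.sum fun σ _ ↦ contDiffOn_const.mul (contDiffOn_prod fun i _ ↦ hF _ _)

/-- Cramer's rule: each entry of the adjugate is the determinant of a matrix whose entries are
constants or entries of `F`. -/
lemma contDiffOn_inv (hF : ∀ i j, ContDiffOn ℝ ∞ (fun z ↦ F z i j) U)
    (hdet : ∀ z ∈ U, (F z).det ≠ 0) (i j : Fin n) :
    ContDiffOn ℝ ∞ (fun z ↦ (F z)⁻¹ i j) U := by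
  simp only [Matrix.inv_def, Ring.inverse_eq_inv', Matrix.smul_apply, smul_eq_mul,
    Matrix.adjugate_apply]
  refine ((contDiffOn_det hF).inv hdet).mul (contDiffOn_det fun a b ↦ ?_)
  by_cases h : a = j
  · subst h
    simpa using contDiffOn_const
  · simpa [Matrix.updateRow_ne h] using hF a b

end MatrixFields

/-! ### The Levi-Civita connection of a metric in coordinates -/

/-- `g` is the matrix of components of a smooth pseudo-Riemannian metric on the open set `U`. -/
structure IsSmoothMetricOn (g : EuclideanSpace ℝ (Fin n) → Matrix (Fin n) (Fin n) ℝ)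
    (U : Set (EuclideanSpace ℝ (Fin n))) : Prop where
  isOpen : IsOpen U
  contDiffOn (i j : Fin n) : ContDiffOn ℝ ∞ (fun z ↦ g z i j) U
  isSymm : ∀ z ∈ U, (g z).IsSymm
  det_ne_zero : ∀ z ∈ U, (g z).det ≠ 0

/-- The connection matrix `(A_c)_{ip} = Γ^p_{ci}`. -/
def connMat (g : EuclideanSpace ℝ (Fin n) → Matrix (Fin n) (Fin n) ℝ) (c : Fin n)
    (y : EuclideanSpace ℝ (Fin n)) : Matrix (Fin n) (Fin n) ℝ :=
  Matrix.of fun i p ↦ christoffel g p c i y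

/-- The curvature matrix `(R_{jk})_{lm} = R_{jkl}{}^m`. -/
def curvMat (g : EuclideanSpace ℝ (Fin n) → Matrix (Fin n) (Fin n) ℝ)
    (y : EuclideanSpace ℝ (Fin n)) (j k : Fin n) : Matrix (Fin n) (Fin n) ℝ :=
  Matrix.of fun l m ↦ riemann g y j k l m

/-- With the lower index as row, covariant constancy of `b` reads `∂_c b = A_c b + b A_cᵀ`, and this
formula reduces the Ricci identity to noncommutative matrix algebra. -/
lemma curvMat_eq (g : EuclideanSpace ℝ (Fin n) → Matrix (Fin n) (Fin n) ℝ)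
    (y : EuclideanSpace ℝ (Fin n)) (j k : Fin n) :
    curvMat g y j k = pdMat k (connMat g j) y - pdMat j (connMat g k) y
      + (connMat g j y * connMat g k y - connMat g k y * connMat g j y) := by
  ext l m
  simp only [curvMat, riemann, pdMat, connMat, Matrix.of_apply, Matrix.add_apply,
    Matrix.sub_apply, Matrix.mul_apply, Finset.sum_sub_distrib]
  simp only [mul_comm]

lemma riemann_antisymm (g : EuclideanSpace ℝ (Fin n) → Matrix (Fin n) (Fin n) ℝ)
    (y : EuclideanSpace ℝ (Fin n)) (j k l m : Fin n) :
    riemann g y j k l m = -riemann g y k j l m := by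
  simp only [riemann, Finset.sum_sub_distrib]
  ring

namespace IsSmoothMetricOn

variable {g : EuclideanSpace ℝ (Fin n) → Matrix (Fin n) (Fin n) ℝ}
  {U : Set (EuclideanSpace ℝ (Fin n))} {y : EuclideanSpace ℝ (Fin n)}

lemma inv_mul (hg : IsSmoothMetricOn g U) (hy : y ∈ U) : (g y)⁻¹ * g y = 1 :=
  Matrix.nonsing_inv_mul _ (hg.det_ne_zero y hy).isUnit

lemma mul_inv (hg : IsSmoothMetricOn g U) (hy : y ∈ U) : g y * (g y)⁻¹ = 1 :=
  Matrix.mul_nonsing_inv _ (hg.det_ne_zero y hy).isUnit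

lemma symm_apply (hg : IsSmoothMetricOn g U) (hy : y ∈ U) (i j : Fin n) : g y i j = g y j i :=
  (hg.isSymm y hy).apply j i

lemma inv_symm (hg : IsSmoothMetricOn g U) (hy : y ∈ U) : (g y)⁻¹.transpose = (g y)⁻¹ := by
  rw [Matrix.transpose_nonsing_inv, hg.isSymm y hy]

lemma inv_symm_apply (hg : IsSmoothMetricOn g U) (hy : y ∈ U) (i j : Fin n) :
    (g y)⁻¹ i j = (g y)⁻¹ j i :=
  congrFun₂ (hg.inv_symm hy) j i

/-! ### Smoothness of the curvature quantities. -/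

lemma contDiffOn_inv (hg : IsSmoothMetricOn g U) (i j : Fin n) :
    ContDiffOn ℝ ∞ (fun z ↦ (g z)⁻¹ i j) U :=
  Coord.contDiffOn_inv hg.contDiffOn hg.det_ne_zero i j

lemma contDiffOn_christoffel (hg : IsSmoothMetricOn g U) (m i j : Fin n) :
    ContDiffOn ℝ ∞ (christoffel g m i j) U := by
  refine contDiffOn_const.mul (ContDiffOn.sum fun p _ ↦ (hg.contDiffOn_inv m p).mul ?_)
  exact ((contDiffOn_pd i hg.isOpen (hg.contDiffOn p j)).add
    (contDiffOn_pd j hg.isOpen (hg.contDiffOn p i))).sub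
    (contDiffOn_pd p hg.isOpen (hg.contDiffOn i j))

lemma contDiffOn_riemann (hg : IsSmoothMetricOn g U) (j k l m : Fin n) :
    ContDiffOn ℝ ∞ (fun z ↦ riemann g z j k l m) U := by
  have hΓ := hg.contDiffOn_christoffel
  exact ((contDiffOn_pd k hg.isOpen (hΓ m j l)).sub (contDiffOn_pd j hg.isOpen (hΓ m k l))).add
    (ContDiffOn.sum fun p _ ↦ ((hΓ m k p).mul (hΓ p j l)).sub ((hΓ m j p).mul (hΓ p k l)))

lemma contDiffOn_ricci (hg : IsSmoothMetricOn g U) (k l : Fin n) :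
    ContDiffOn ℝ ∞ (fun z ↦ ricci g z k l) U :=
  (ContDiffOn.sum fun m _ ↦ hg.contDiffOn_riemann m k l m).neg

lemma contDiffOn_ricciUp (hg : IsSmoothMetricOn g U) (k l : Fin n) :
    ContDiffOn ℝ ∞ (fun z ↦ ricciUp g z k l) U :=
  ContDiffOn.sum fun p _ ↦ (hg.contDiffOn_ricci k p).mul (hg.contDiffOn_inv p l)

lemma contDiffOn_scalarCurv (hg : IsSmoothMetricOn g U) :
    ContDiffOn ℝ ∞ (fun z ↦ scalarCurv g z) U :=
  ContDiffOn.sum fun i _ ↦ ContDiffOn.sum fun j _ ↦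
    (hg.contDiffOn_inv i j).mul (hg.contDiffOn_ricci i j)

lemma contDiffOn_weyl (hg : IsSmoothMetricOn g U) (j k l m : Fin n) :
    ContDiffOn ℝ ∞ (fun z ↦ weyl g z j k l m) U := by
  have h1 := hg.contDiffOn_ricci
  have h2 := hg.contDiffOn_ricciUp
  have h3 := hg.contDiffOn
  refine ((hg.contDiffOn_riemann j k l m).add (contDiffOn_const.mul ?_)).sub
    ((hg.contDiffOn_scalarCurv.mul
      ((contDiffOn_const.mul (h3 k l)).sub (contDiffOn_const.mul (h3 j l)))).div_const _)
  exact (((contDiffOn_const.mul (h1 k l)).sub (contDiffOn_const.mul (h1 j l))).add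
    ((h2 j m).mul (h3 k l))).sub ((h2 k m).mul (h3 j l))

lemma contDiffOn_weylLow (hg : IsSmoothMetricOn g U) (j k l m : Fin n) :
    ContDiffOn ℝ ∞ (fun z ↦ weylLow g z j k l m) U :=
  ContDiffOn.sum fun p _ ↦ (hg.contDiffOn_weyl j k l p).mul (hg.contDiffOn p m)

lemma contDiffOn_weylUp (hg : IsSmoothMetricOn g U) (j k l m : Fin n) :
    ContDiffOn ℝ ∞ (fun z ↦ weylUp g z j k l m) U :=
  ContDiffOn.sum fun p _ ↦ ContDiffOn.sum fun q _ ↦ ContDiffOn.sum fun r _ ↦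
    (((hg.contDiffOn_inv k p).mul (hg.contDiffOn_inv l q)).mul (hg.contDiffOn_inv m r)).mul
      (hg.contDiffOn_weylLow j p q r)

lemma contDiffOn_weylContr (hg : IsSmoothMetricOn g U) (i j : Fin n) :
    ContDiffOn ℝ ∞ (fun z ↦ weylContr g z i j) U :=
  ContDiffOn.sum fun p _ ↦ ContDiffOn.sum fun q _ ↦ ContDiffOn.sum fun r _ ↦
    (hg.contDiffOn_weylUp i p q r).mul (hg.contDiffOn_weylLow j p q r)

lemma contDiffOn_weylSq (hg : IsSmoothMetricOn g U) :
    ContDiffOn ℝ ∞ (fun z ↦ weylSq g z) U :=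
  ContDiffOn.sum fun i _ ↦ ContDiffOn.sum fun j _ ↦
    (hg.contDiffOn_inv i j).mul (hg.contDiffOn_weylContr i j)

lemma contDiffOn_hTensor (hg : IsSmoothMetricOn g U) (h0 : ∀ z ∈ U, weylSq g z ≠ 0)
    (i j : Fin n) : ContDiffOn ℝ ∞ (fun z ↦ hTensor g z i j) U :=
  (hg.contDiffOn_weylContr i j).div hg.contDiffOn_weylSq h0

lemma differentiableAt_of_contDiffOn (hg : IsSmoothMetricOn g U) (hy : y ∈ U)
    {f : EuclideanSpace ℝ (Fin n) → ℝ} (hf : ContDiffOn ℝ ∞ f U) : DifferentiableAt ℝ f y :=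
  (hf.contDiffAt (hg.isOpen.mem_nhds hy)).differentiableAt (by simp)

/-! ### Torsion-freeness, metricity, and the Ricci and Bianchi identities. -/

lemma pd_symm (hg : IsSmoothMetricOn g U) (hy : y ∈ U) (c i j : Fin n) :
    pd c (fun z ↦ g z i j) y = pd c (fun z ↦ g z j i) y :=
  pd_congr c ((hg.isOpen.eventually_mem hy).mono fun _ hz ↦ hg.symm_apply hz i j)

lemma christoffel_symm (hg : IsSmoothMetricOn g U) (hy : y ∈ U) (m i j : Fin n) :
    christoffel g m i j y = christoffel g m j i y := by
  simp only [christoffel]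
  congr 1
  refine Finset.sum_congr rfl fun p _ ↦ ?_
  rw [hg.pd_symm hy p i j]
  ring

lemma sum_christoffel_mul (hg : IsSmoothMetricOn g U) (hy : y ∈ U) (i j k : Fin n) :
    ∑ p, christoffel g p i j y * g y p k = (1 / 2) * (pd i (fun z ↦ g z k j) y
      + pd j (fun z ↦ g z k i) y - pd k (fun z ↦ g z i j) y) := by
  set w : Fin n → ℝ := fun p ↦ pd i (fun z ↦ g z p j) y
      + pd j (fun z ↦ g z p i) y - pd p (fun z ↦ g z i j) y with hw
  have h1 : (g y).mulVec ((g y)⁻¹.mulVec w) = w := by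
    rw [Matrix.mulVec_mulVec, hg.mul_inv hy, Matrix.one_mulVec]
  have h2 := congrFun h1 k
  simp only [Matrix.mulVec, dotProduct] at h2
  change _ = 1 / 2 * w k
  rw [← h2, Finset.mul_sum]
  refine Finset.sum_congr rfl fun p _ ↦ ?_
  rw [hg.symm_apply hy p k, christoffel]
  ring

/-- The Levi-Civita connection is metric. -/
lemma pdMat_metric (hg : IsSmoothMetricOn g U) (hy : y ∈ U) (c : Fin n) :
    pdMat c g y = connMat g c y * g y + g y * (connMat g c y).transpose := by
  ext i j
  simp only [pdMat, connMat, Matrix.of_apply, Matrix.add_apply, Matrix.mul_apply,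
    Matrix.transpose_apply]
  rw [hg.sum_christoffel_mul hy]
  have : ∑ p, g y i p * christoffel g p c j y = ∑ p, christoffel g p c j y * g y p i :=
    Finset.sum_congr rfl fun p _ ↦ by rw [hg.symm_apply hy i p, mul_comm]
  rw [this, hg.sum_christoffel_mul hy, hg.pd_symm hy c j i, hg.pd_symm hy i j c,
    hg.pd_symm hy j i c]
  ring

/-- Differentiate `g⁻¹ g = 1`, insert `pdMat_metric` and multiply by `g⁻¹` on the right. -/
lemma pdMat_inv (hg : IsSmoothMetricOn g U) (hy : y ∈ U) (c : Fin n) :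
    pdMat c (fun z ↦ (g z)⁻¹) y
      = -((g y)⁻¹ * connMat g c y + (connMat g c y).transpose * (g y)⁻¹) := by
  have h1 : pdMat c (fun z ↦ (g z)⁻¹ * g z) y = 0 := by
    rw [pdMat_congr c ((hg.isOpen.eventually_mem hy).mono fun z hz ↦ hg.inv_mul hz)]
    ext i j
    exact pd_const c _
  rw [pdMat_mul c (fun i j ↦ hg.differentiableAt_of_contDiffOn hy (hg.contDiffOn_inv i j))
    (fun i j ↦ hg.differentiableAt_of_contDiffOn hy (hg.contDiffOn i j)),
    hg.pdMat_metric hy c] at h1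
  have h2 := congrArg (· * (g y)⁻¹) h1
  simp only [add_mul, mul_add, zero_mul, Matrix.mul_assoc, hg.mul_inv hy, Matrix.mul_one] at h2
  rw [← Matrix.mul_assoc (g y)⁻¹ (g y), hg.inv_mul hy, Matrix.one_mul] at h2
  rw [eq_neg_iff_add_eq_zero]
  exact h2

/-- The Ricci identity for a covariantly constant two-tensor. -/
lemma curvMat_mul_add_mul_transpose_eq_zero (hg : IsSmoothMetricOn g U) (hy : y ∈ U)
    {b : EuclideanSpace ℝ (Fin n) → Matrix (Fin n) (Fin n) ℝ}
    (hb : ∀ i j, ContDiffOn ℝ ∞ (fun z ↦ b z i j) U)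
    (hpar : ∀ z ∈ U, ∀ c, pdMat c b z = connMat g c z * b z + b z * (connMat g c z).transpose)
    (j k : Fin n) :
    curvMat g y j k * b y + b y * (curvMat g y j k).transpose = 0 := by
  have hbd (i j) := hg.differentiableAt_of_contDiffOn hy (hb i j)
  have hA (c i j) : DifferentiableAt ℝ (fun z ↦ connMat g c z i j) y :=
    hg.differentiableAt_of_contDiffOn hy (hg.contDiffOn_christoffel j c i)
  have hmul {F H : EuclideanSpace ℝ (Fin n) → Matrix (Fin n) (Fin n) ℝ}
      (hF : ∀ i j, DifferentiableAt ℝ (fun z ↦ F z i j) y)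
      (hH : ∀ i j, DifferentiableAt ℝ (fun z ↦ H z i j) y) (i j) :
      DifferentiableAt ℝ (fun z ↦ (F z * H z) i j) y := by
    simp only [Matrix.mul_apply]
    exact DifferentiableAt.fun_sum fun p _ ↦ (hF i p).mul (hH p j)
  have key (c d : Fin n) : pdMat d (pdMat c b) y =
      pdMat d (connMat g c) y * b y
        + connMat g c y * (connMat g d y * b y + b y * (connMat g d y).transpose)
        + ((connMat g d y * b y + b y * (connMat g d y).transpose) * (connMat g c y).transpose
        + b y * (pdMat d (connMat g c) y).transpose) := by
    rw [pdMat_congr d ((hg.isOpen.eventually_mem hy).mono fun z hz ↦ hpar z hz c),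
      pdMat_add d (hmul (hA c) hbd) (hmul (H := fun z ↦ (connMat g c z).transpose) hbd
        fun i j ↦ by simpa using hA c j i), pdMat_mul d (hA c) hbd,
      pdMat_mul (H := fun z ↦ (connMat g c z).transpose) d hbd
        (fun i j ↦ by simpa using hA c j i), pdMat_transpose, hpar y hy d]
  -- In the difference of the two orders of differentiation the mixed terms `A_j b A_kᵀ + A_k b
  -- A_jᵀ` cancel, leaving the curvature acting on each index of `b`.
  have hcomm : pdMat k (pdMat j b) y = pdMat j (pdMat k b) y := by
    ext p q
    exact pd_comm k j ((hb p q).contDiffAt (hg.isOpen.mem_nhds hy))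
  rw [key, key, ← sub_eq_zero] at hcomm
  rw [curvMat_eq, ← hcomm]
  simp only [Matrix.transpose_add, Matrix.transpose_sub, Matrix.transpose_mul]
  noncomm_ring

/-- The first Bianchi identity. -/
lemma riemann_cyclic (hg : IsSmoothMetricOn g U) (hy : y ∈ U) (j k l m : Fin n) :
    riemann g y j k l m + riemann g y k l j m + riemann g y l j k m = 0 := by
  have hpd (c a b) : pd c (christoffel g m a b) y = pd c (christoffel g m b a) y :=
    pd_congr c ((hg.isOpen.eventually_mem hy).mono fun z hz ↦ hg.christoffel_symm hz m a b)
  simp only [riemann, Finset.sum_sub_distrib]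
  -- Once the lower indices of every `Γ` are in a fixed order, derivatives and products cancel in
  -- pairs.
  rw [hpd k j l, hpd j k l, hpd l k j]
  simp only [hg.christoffel_symm hy _ l j, hg.christoffel_symm hy _ l k,
    hg.christoffel_symm hy _ k j]
  ring

end IsSmoothMetricOn

/-! ### Compatibility -/

section Algebra

variable {g : EuclideanSpace ℝ (Fin n) → Matrix (Fin n) (Fin n) ℝ}
  {U : Set (EuclideanSpace ℝ (Fin n))} {y : EuclideanSpace ℝ (Fin n)}
  {b : Fin n → Fin n → ℝ}

/-- If every curvature operator annihilates `b`, then `b` is Riemann compatible. -/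
lemma IsSmoothMetricOn.isCompatible_riemann (hg : IsSmoothMetricOn g U) (hy : y ∈ U)
    (hann : ∀ i j k l, ∑ m, b i m * riemann g y j k l m = -∑ m, b l m * riemann g y j k i m) :
    IsCompatible (riemann g y) b := by
  intro i j k l
  rw [Finset.sum_add_distrib, Finset.sum_add_distrib, hann i j k l, hann j k i l, hann k i j l,
    ← neg_add, ← neg_add, ← Finset.sum_add_distrib, ← Finset.sum_add_distrib, neg_eq_zero]
  refine Finset.sum_eq_zero fun m _ ↦ ?_
  linear_combination b l m * hg.riemann_cyclic hy j k i m

lemma sum_mul_kron (c : Fin n → ℝ) (j : Fin n) : ∑ m, c m * kron j m = c j := by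
  simp [kron]

/-- A symmetric tensor commuting with the Ricci tensor is Weyl compatible as soon as it is
Riemann compatible. -/
lemma isCompatible_weyl (hb : ∀ i j, b i j = b j i) (hR : IsCompatible (riemann g y) b)
    (hcomm : CommutesWithRicciAt g b y) : IsCompatible (weyl g y) b := by
  have hs (i j : Fin n) : ∑ m, b i m * ricciUp g y j m = ∑ m, b j m * ricciUp g y i m := by
    rw [hcomm i j]
    exact Finset.sum_congr rfl fun m _ ↦ mul_comm _ _
  have key (i j k l : Fin n) : ∑ m, b i m * weyl g y j k l m =
      ∑ m, b i m * riemann g y j k l m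
      + (1 / ((n : ℝ) - 2)) * (b i j * ricci g y k l - b i k * ricci g y j l
        + (∑ m, b i m * ricciUp g y j m) * g y k l - (∑ m, b i m * ricciUp g y k m) * g y j l)
      - scalarCurv g y * (b i j * g y k l - b i k * g y j l)
        / (((n : ℝ) - 1) * ((n : ℝ) - 2)) := by
    rw [← sum_mul_kron (b i) j, ← sum_mul_kron (b i) k]
    simp only [Finset.sum_mul, ← Finset.sum_add_distrib, ← Finset.sum_sub_distrib, Finset.mul_sum,
      Finset.sum_div]
    refine Finset.sum_congr rfl fun m _ ↦ ?_
    simp only [weyl]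
    ring
  intro i j k l
  have h := hR i j k l
  rw [Finset.sum_add_distrib, Finset.sum_add_distrib] at h ⊢
  -- Both `b_{ij}` and `b_{im} R_j{}^m` are symmetric, so each Ricci or scalar term occurs twice in
  -- the cyclic sum, with opposite signs.
  rw [key, key, key, hs j i, hs k i, hs k j, hb j i, hb k i, hb k j]
  linear_combination h

/-- The covariant Riemann tensor `R_{jklm}`. -/
def riemannLow (g : EuclideanSpace ℝ (Fin n) → Matrix (Fin n) (Fin n) ℝ)
    (y : EuclideanSpace ℝ (Fin n)) (j k l m : Fin n) : ℝ :=
  ∑ p, riemann g y j k l p * g y p m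

lemma IsSmoothMetricOn.sum_riemannLow_mul_inv (hg : IsSmoothMetricOn g U) (hy : y ∈ U)
    (j k l m : Fin n) : ∑ p, riemannLow g y j k l p * (g y)⁻¹ p m = riemann g y j k l m := by
  have h : curvMat g y j k * g y * (g y)⁻¹ = curvMat g y j k := by
    rw [Matrix.mul_assoc, hg.mul_inv hy, Matrix.mul_one]
  simpa [Matrix.mul_apply, curvMat, riemannLow] using congrFun₂ h l m

/-- This is the Ricci identity applied to the metric itself, which is parallel. -/
lemma IsSmoothMetricOn.riemannLow_antisymm_right (hg : IsSmoothMetricOn g U) (hy : y ∈ U)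
    (j k l m : Fin n) : riemannLow g y j k l m = -riemannLow g y j k m l := by
  have h := congrFun₂ (hg.curvMat_mul_add_mul_transpose_eq_zero hy hg.contDiffOn
    (fun z hz c ↦ hg.pdMat_metric hz c) j k) l m
  simp only [Matrix.add_apply, Matrix.mul_apply, Matrix.transpose_apply, Matrix.zero_apply,
    curvMat, Matrix.of_apply] at h
  rw [eq_neg_iff_add_eq_zero, ← h]
  simp only [riemannLow]
  congr 1
  exact Finset.sum_congr rfl fun p _ ↦ by rw [hg.symm_apply hy l p, mul_comm]

lemma IsSmoothMetricOn.ricci_eq (hg : IsSmoothMetricOn g U) (hy : y ∈ U) (k l : Fin n) :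
    ricci g y k l = -∑ m, ∑ p, (g y)⁻¹ m p * riemannLow g y m k l p := by
  simp only [ricci]
  congr 1
  refine Finset.sum_congr rfl fun m _ ↦ ?_
  rw [← hg.sum_riemannLow_mul_inv hy]
  exact Finset.sum_congr rfl fun p _ ↦ by rw [hg.inv_symm_apply hy, mul_comm]

/-- A symmetric Riemann compatible tensor commutes with the Ricci tensor. -/
lemma IsSmoothMetricOn.commutesWithRicciAt (hg : IsSmoothMetricOn g U) (hy : y ∈ U)
    (hb : ∀ i j, b i j = b j i) (hR : IsCompatible (riemann g y) b) :
    CommutesWithRicciAt g b y := by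
  -- Contracting the first and third indices instead of the first and fourth changes the sign, by
  -- antisymmetry in the last pair; this absorbs the minus sign in `ricci`.
  have hup (k m : Fin n) :
      ∑ j, ∑ l, (g y)⁻¹ j l * riemann g y j k l m = ricciUp g y k m := by
    have h1 : ∀ p, ∑ j, ∑ l, (g y)⁻¹ j l * riemannLow g y j k l p = ricci g y k p := fun p ↦ by
      rw [hg.ricci_eq hy, ← Finset.sum_neg_distrib]
      refine Finset.sum_congr rfl fun j _ ↦ ?_
      rw [← Finset.sum_neg_distrib]
      refine Finset.sum_congr rfl fun l _ ↦ ?_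
      rw [hg.riemannLow_antisymm_right hy j k l p]
      ring
    simp only [ricciUp, ← h1, ← hg.sum_riemannLow_mul_inv hy _ _ _ m, Finset.sum_mul,
      Finset.mul_sum, mul_assoc]
    rw [Finset.sum_comm_cycle, Finset.sum_comm_cycle]
  have hcontr (i k : Fin n) : ∑ j, ∑ l, (g y)⁻¹ j l * ∑ m, b i m * riemann g y j k l m
      = ∑ m, b i m * ricciUp g y k m := by
    simp only [← hup, Finset.mul_sum]
    rw [Finset.sum_comm_cycle]
    refine Finset.sum_congr rfl fun m _ ↦ Finset.sum_congr rfl fun j _ ↦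
      Finset.sum_congr rfl fun l _ ↦ by ring
  -- The symmetric `g⁻¹ b g⁻¹` is paired with `R_{kilm}`, antisymmetric in `l, m`; the trace equals
  -- its own negative.
  have hzero (i k : Fin n) :
      ∑ j, ∑ l, (g y)⁻¹ j l * ∑ m, b j m * riemann g y k i l m = 0 := by
    let G := (g y)⁻¹
    let B : Matrix (Fin n) (Fin n) ℝ := Matrix.of b
    let Q : Matrix (Fin n) (Fin n) ℝ := Matrix.of (riemannLow g y k i)
    have hGt : G.transpose = G := hg.inv_symm hy
    have hBt : B.transpose = B := Matrix.ext fun p q ↦ hb q p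
    have hQt : Q.transpose = -Q := Matrix.ext fun p q ↦ hg.riemannLow_antisymm_right hy k i q p
    have h1 : (G * B * G * Q).trace = -(G * B * G * Q).trace := by
      conv_lhs => rw [← Matrix.trace_transpose]
      simp only [Matrix.transpose_mul, hGt, hBt, hQt, neg_mul, Matrix.trace_neg]
      rw [Matrix.trace_mul_comm, ← Matrix.mul_assoc]
    have h2 : ∑ j, ∑ l, G j l * ∑ m, b j m * riemann g y k i l m
        = (G * (B * (Q * G).transpose)).trace := by
      have hB (j l : Fin n) : ∑ m, b j m * riemann g y k i l m = (B * (Q * G).transpose) j l := by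
        rw [Matrix.mul_apply]
        refine Finset.sum_congr rfl fun m _ ↦ ?_
        rw [← hg.sum_riemannLow_mul_inv hy k i l m, Matrix.transpose_apply, Matrix.mul_apply]
        rfl
      simp only [hB]
      change ∑ j, ∑ l, (g y)⁻¹ j l * _ = _
      rw [Finset.sum_comm]
      refine Finset.sum_congr rfl fun l _ ↦ ?_
      rw [Matrix.diag_apply, Matrix.mul_apply]
      exact Finset.sum_congr rfl fun j _ ↦ by rw [hg.inv_symm_apply hy j l]
    rw [h2, Matrix.transpose_mul, hQt, hGt]
    simp only [mul_neg, Matrix.trace_neg, ← Matrix.mul_assoc]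
    linarith
  intro i k
  -- Riemann compatibility contracted with `g^{jl}`, the third term rewritten by `R_{ijl}{}^m =
  -- -R_{jil}{}^m` so that `hcontr` applies to it too.
  have h : ∑ j, ∑ l, (g y)⁻¹ j l * (∑ m, b i m * riemann g y j k l m
      + ∑ m, b j m * riemann g y k i l m - ∑ m, b k m * riemann g y j i l m) = 0 := by
    refine Finset.sum_eq_zero fun j _ ↦ Finset.sum_eq_zero fun l _ ↦ ?_
    have := hR i j k l
    simp only [Finset.sum_add_distrib, riemann_antisymm g y i j, mul_neg,
      Finset.sum_neg_distrib] at this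
    rw [sub_eq_add_neg, this, mul_zero]
  simp only [mul_add, mul_sub, Finset.sum_add_distrib, Finset.sum_sub_distrib, hcontr,
    hzero] at h
  simp only [mul_comm (ricciUp g y i _)]
  linarith

end Algebra

/-! ### Contractions of covariantly recurrent tensors -/

section Contraction

variable {y : EuclideanSpace ℝ (Fin n)}

/-- Cyclicity of the trace: the connection terms of a contravariant pair balance those of the
covariant pair it is contracted with. -/
lemma sum_dual_action (A G B : Matrix (Fin n) (Fin n) ℝ) :
    ∑ k, ∑ p, (G * A + A.transpose * G) k p * B k p
      = ∑ k, ∑ p, G k p * (A * B + B * A.transpose) k p := by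
  have tr (P Q : Matrix (Fin n) (Fin n) ℝ) :
      ∑ k, ∑ p, P k p * Q k p = (P.transpose * Q).trace := by
    simp only [Matrix.trace, Matrix.diag_apply, Matrix.mul_apply, Matrix.transpose_apply]
    exact Finset.sum_comm
  rw [tr, tr, Matrix.transpose_add, Matrix.transpose_mul, Matrix.transpose_mul,
    Matrix.transpose_transpose, Matrix.add_mul, Matrix.mul_add, Matrix.trace_add, Matrix.trace_add,
    Matrix.mul_assoc, Matrix.mul_assoc, Matrix.trace_mul_comm A.transpose, add_comm,
    Matrix.mul_assoc]

/-- Contraction with the inverse metric commutes with covariant differentiation. -/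
lemma pd_contract (c : Fin n) {G : EuclideanSpace ℝ (Fin n) → Matrix (Fin n) (Fin n) ℝ}
    {A X : Matrix (Fin n) (Fin n) ℝ} {B : Fin n → Fin n → EuclideanSpace ℝ (Fin n) → ℝ}
    (hGd : ∀ i j, DifferentiableAt ℝ (fun z ↦ G z i j) y)
    (hBd : ∀ i j, DifferentiableAt ℝ (B i j) y)
    (hG : pdMat c G y = -(G y * A + A.transpose * G y))
    (hB : ∀ k p, pd c (B k p) y = X k p + ∑ a, (A k a * B a p y + A p a * B k a y)) :
    pd c (fun z ↦ ∑ k, ∑ p, G z k p * B k p z) y = ∑ k, ∑ p, G y k p * X k p := by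
  have h1 := sum_dual_action A (G y) (Matrix.of fun k p ↦ B k p y)
  have h2 (k p) : (A * (Matrix.of fun k p ↦ B k p y)
      + (Matrix.of fun k p ↦ B k p y) * A.transpose) k p = pd c (B k p) y - X k p := by
    rw [hB]
    simp only [Matrix.add_apply, Matrix.mul_apply, Matrix.of_apply, Matrix.transpose_apply,
      Finset.sum_add_distrib, add_sub_cancel_left]
    congr 1
    exact Finset.sum_congr rfl fun a _ ↦ mul_comm _ _
  have h3 (k p) : (G y * A + A.transpose * G y) k p = -pd c (fun z ↦ G z k p) y := by
    have := congrFun₂ hG k p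
    simp only [pdMat, Matrix.of_apply, Matrix.neg_apply] at this
    rw [this, neg_neg]
  simp only [h2, h3, Matrix.of_apply, mul_sub, Finset.sum_sub_distrib, neg_mul,
    Finset.sum_neg_distrib] at h1
  rw [pd_sum _ _ fun k _ ↦ DifferentiableAt.fun_sum fun p _ ↦ (hGd k p).fun_mul (hBd k p)]
  have h4 (k) : pd c (fun z ↦ ∑ p, G z k p * B k p z) y
      = ∑ p, pd c (fun z ↦ G z k p) y * B k p y + ∑ p, G y k p * pd c (B k p) y := by
    rw [pd_sum _ _ fun p _ ↦ (hGd k p).fun_mul (hBd k p), ← Finset.sum_add_distrib]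
    exact Finset.sum_congr rfl fun p _ ↦ pd_mul c (hGd k p) (hBd k p)
  simp only [h4, Finset.sum_add_distrib]
  linear_combination -h1

lemma sum_contract_add_sum (G B : Fin n → Fin n → ℝ) (S : Fin n → Fin n → Fin n → ℝ) (s : ℝ) :
    ∑ k, ∑ p, G k p * (s * B k p + ∑ a, S a k p)
      = s * ∑ k, ∑ p, G k p * B k p + ∑ a, ∑ k, ∑ p, G k p * S a k p := by
  simp only [mul_add, Finset.sum_add_distrib, Finset.mul_sum]
  congr 1
  · exact Finset.sum_congr rfl fun k _ ↦ Finset.sum_congr rfl fun p _ ↦ by ring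
  · rw [Finset.sum_comm_cycle]

end Contraction

/-! ### Recurrence of the Weyl tensor and parallelism of `h`. -/

section Recurrence

variable {g : EuclideanSpace ℝ (Fin n) → Matrix (Fin n) (Fin n) ℝ}
  {U : Set (EuclideanSpace ℝ (Fin n))} {y : EuclideanSpace ℝ (Fin n)}

/-- Nesting the contractions one index pair at a time lets `pd_contract_inv` be applied level by
level. -/
lemma weylContr_eq_sum (g : EuclideanSpace ℝ (Fin n) → Matrix (Fin n) (Fin n) ℝ)
    (y : EuclideanSpace ℝ (Fin n)) (i j : Fin n) :
    weylContr g y i j = ∑ k, ∑ p, (g y)⁻¹ k p * ∑ l, ∑ q, (g y)⁻¹ l q * ∑ m, ∑ r, (g y)⁻¹ m r *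
      (weylLow g y i p q r * weylLow g y j k l m) := by
  simp only [weylContr, weylUp, Finset.sum_mul, Finset.mul_sum]
  refine Finset.sum_congr rfl fun k _ ↦ ?_
  refine Finset.sum_comm_cycle.trans ?_
  refine Finset.sum_congr rfl fun p _ ↦ Finset.sum_congr rfl fun l _ ↦ Finset.sum_comm.trans ?_
  refine Finset.sum_congr rfl fun q _ ↦ Finset.sum_congr rfl fun m _ ↦
    Finset.sum_congr rfl fun r _ ↦ by ring

namespace IsSmoothMetricOn

lemma weylContr_symm (hg : IsSmoothMetricOn g U) (hy : y ∈ U) (i j : Fin n) :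
    weylContr g y i j = weylContr g y j i := by
  simp only [weylContr_eq_sum]
  rw [Finset.sum_comm]
  refine Finset.sum_congr rfl fun k _ ↦ Finset.sum_congr rfl fun p _ ↦ ?_
  rw [hg.inv_symm_apply hy, Finset.sum_comm]
  congr 1
  refine Finset.sum_congr rfl fun l _ ↦ Finset.sum_congr rfl fun q _ ↦ ?_
  rw [hg.inv_symm_apply hy, Finset.sum_comm]
  congr 1
  refine Finset.sum_congr rfl fun m _ ↦ Finset.sum_congr rfl fun r _ ↦ ?_
  rw [hg.inv_symm_apply hy, mul_comm (weylLow g y i _ _ _)]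

lemma hTensor_symm (hg : IsSmoothMetricOn g U) (hy : y ∈ U) (i j : Fin n) :
    hTensor g y i j = hTensor g y j i := by
  rw [hTensor, hTensor, hg.weylContr_symm hy]

/-- `S` collects the connection terms of the indices not being contracted. They survive in the
conclusion, which therefore has the shape needed to contract the next pair. -/
lemma pd_contract_inv (hg : IsSmoothMetricOn g U) (hy : y ∈ U) (c : Fin n)
    {B : Fin n → Fin n → EuclideanSpace ℝ (Fin n) → ℝ}
    (hBd : ∀ i j, DifferentiableAt ℝ (B i j) y) {s : ℝ}
    {S : Fin n → Fin n → Fin n → ℝ}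
    (hB : ∀ k p, pd c (B k p) y = (s * B k p y + ∑ a, S a k p)
      + ∑ a, (connMat g c y k a * B a p y + connMat g c y p a * B k a y)) :
    pd c (fun z ↦ ∑ k, ∑ p, (g z)⁻¹ k p * B k p z) y
      = s * ∑ k, ∑ p, (g y)⁻¹ k p * B k p y + ∑ a, ∑ k, ∑ p, (g y)⁻¹ k p * S a k p := by
  rw [pd_contract c (fun i j ↦ hg.differentiableAt_of_contDiffOn hy (hg.contDiffOn_inv i j)) hBd
    (X := Matrix.of fun k p ↦ s * B k p y + ∑ a, S a k p) (hg.pdMat_inv hy c) hB]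
  exact sum_contract_add_sum _ (fun k p ↦ B k p y) S s

variable {c : Fin n} {s : ℝ}

/-- If `∇_c C_{jklm} = s C_{jklm}` then `∇_c (C_i{}^{klm} C_{jklm}) = 2 s C_i{}^{klm} C_{jklm}`. -/
lemma pd_weylContr (hg : IsSmoothMetricOn g U) (hy : y ∈ U)
    (hrec : ∀ j k l m, covDeriv₄ g (weylLow g) y c j k l m = s * weylLow g y j k l m)
    (i j : Fin n) :
    pd c (fun z ↦ weylContr g z i j) y = 2 * s * weylContr g y i j
      + ∑ a, (connMat g c y i a * weylContr g y a j + connMat g c y j a * weylContr g y i a) := by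
  have hC (j k l m : Fin n) : pd c (fun z ↦ weylLow g z j k l m) y = s * weylLow g y j k l m
      + ∑ a, (connMat g c y j a * weylLow g y a k l m + connMat g c y k a * weylLow g y j a l m
        + connMat g c y l a * weylLow g y j k a m + connMat g c y m a * weylLow g y j k l a) := by
    have h := hrec j k l m
    rw [covDeriv₄, sub_eq_iff_eq_add] at h
    exact h
  have hCd (j k l m : Fin n) : DifferentiableAt ℝ (fun z ↦ weylLow g z j k l m) y :=
    hg.differentiableAt_of_contDiffOn hy (hg.contDiffOn_weylLow j k l m)
  have hGd (i j : Fin n) : DifferentiableAt ℝ (fun z ↦ (g z)⁻¹ i j) y :=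
    hg.differentiableAt_of_contDiffOn hy (hg.contDiffOn_inv i j)
  set A := connMat g c y with hA
  -- Innermost contraction, over `m, r`. The factor `2 * s` comes from the two Weyl factors, and `S`
  -- lists the six indices still free; four remain in `h2` and two in `h3`.
  have h1 (i p q j k l : Fin n) := hg.pd_contract_inv hy c (s := 2 * s)
    (B := fun m r z ↦ weylLow g z i p q r * weylLow g z j k l m)
    (S := fun a m r ↦
      A i a * (weylLow g y a p q r * weylLow g y j k l m)
      + A p a * (weylLow g y i a q r * weylLow g y j k l m)
      + A q a * (weylLow g y i p a r * weylLow g y j k l m)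
      + A j a * (weylLow g y i p q r * weylLow g y a k l m)
      + A k a * (weylLow g y i p q r * weylLow g y j a l m)
      + A l a * (weylLow g y i p q r * weylLow g y j k a m))
    (fun m r ↦ (hCd _ _ _ _).fun_mul (hCd _ _ _ _))
    (fun m r ↦ by
      rw [pd_mul c (hCd _ _ _ _) (hCd _ _ _ _), hC, hC, add_mul, mul_add, Finset.sum_mul,
        Finset.mul_sum, add_add_add_comm, add_assoc (2 * s * _), ← Finset.sum_add_distrib,
        ← Finset.sum_add_distrib]
      congr 1
      · ring
      · exact Finset.sum_congr rfl fun a _ ↦ by ring)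
  have hd1 (i p q j k l : Fin n) : DifferentiableAt ℝ (fun z ↦ ∑ m, ∑ r, (g z)⁻¹ m r *
      (weylLow g z i p q r * weylLow g z j k l m)) y :=
    DifferentiableAt.fun_sum fun m _ ↦ DifferentiableAt.fun_sum fun r _ ↦
      (hGd m r).fun_mul ((hCd _ _ _ _).fun_mul (hCd _ _ _ _))
  -- Moving the connection entries out of the sums over `m, r` leaves the same contraction with one
  -- index replaced, later recognised as `D1`.
  simp only [mul_add, Finset.sum_add_distrib, mul_left_comm _ (A _ _), ← Finset.mul_sum] at h1
  set D1 : Fin n → Fin n → Fin n → Fin n → Fin n → Fin n → EuclideanSpace ℝ (Fin n) → ℝ :=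
    fun i p q j k l z ↦ ∑ m, ∑ r, (g z)⁻¹ m r *
      (weylLow g z i p q r * weylLow g z j k l m) with hD1
  have h2 (i p j k : Fin n) := hg.pd_contract_inv hy c (s := 2 * s)
    (B := fun l q z ↦ D1 i p q j k l z)
    (S := fun a l q ↦ A i a * D1 a p q j k l y + A p a * D1 i a q j k l y
      + A j a * D1 i p q a k l y + A k a * D1 i p q j a l y)
    (fun l q ↦ hd1 _ _ _ _ _ _)
    (fun l q ↦ by
      simp only [hD1, Finset.sum_add_distrib]
      rw [h1]
      ring)
  have hd2 (i p j k : Fin n) :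
      DifferentiableAt ℝ (fun z ↦ ∑ l, ∑ q, (g z)⁻¹ l q * D1 i p q j k l z) y :=
    DifferentiableAt.fun_sum fun m _ ↦ DifferentiableAt.fun_sum fun r _ ↦
      (hGd m r).fun_mul (hd1 _ _ _ _ _ _)
  simp only [mul_add, Finset.sum_add_distrib, mul_left_comm _ (A _ _), ← Finset.mul_sum] at h2
  set D2 : Fin n → Fin n → Fin n → Fin n → EuclideanSpace ℝ (Fin n) → ℝ :=
    fun i p j k z ↦ ∑ l, ∑ q, (g z)⁻¹ l q * D1 i p q j k l z with hD2
  have h3 := hg.pd_contract_inv hy c (s := 2 * s)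
    (B := fun k p z ↦ D2 i p j k z)
    (S := fun a k p ↦ A i a * D2 a p j k y + A j a * D2 i p a k y)
    (fun k p ↦ hd2 _ _ _ _)
    (fun k p ↦ by
      simp only [hD2, Finset.sum_add_distrib]
      rw [h2]
      ring)
  simp only [mul_add, Finset.sum_add_distrib, mul_left_comm _ (A _ _), ← Finset.mul_sum] at h3
  simp only [weylContr_eq_sum, Finset.sum_add_distrib]
  exact h3

/-- After the last contraction no index is free, hence `S = 0`. -/
lemma pd_weylSq (hg : IsSmoothMetricOn g U) (hy : y ∈ U)
    (hrec : ∀ j k l m, covDeriv₄ g (weylLow g) y c j k l m = s * weylLow g y j k l m) :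
    pd c (fun z ↦ weylSq g z) y = 2 * s * weylSq g y := by
  have h := hg.pd_contract_inv hy c (s := 2 * s) (B := fun i j z ↦ weylContr g z i j)
    (S := fun _ _ _ ↦ 0)
    (fun i j ↦ hg.differentiableAt_of_contDiffOn hy (hg.contDiffOn_weylContr i j))
    (fun i j ↦ by rw [hg.pd_weylContr hy hrec]; simp)
  simpa [weylSq] using h

/-- If `∇_c C_{jklm} = s C_{jklm}` and `C² ≠ 0` then `∇_c h_{ij} = 0`. -/
lemma pd_hTensor (hg : IsSmoothMetricOn g U) (hy : y ∈ U) (h0 : weylSq g y ≠ 0)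
    (hrec : ∀ j k l m, covDeriv₄ g (weylLow g) y c j k l m = s * weylLow g y j k l m)
    (i j : Fin n) :
    pd c (fun z ↦ hTensor g z i j) y =
      ∑ a, (connMat g c y i a * hTensor g y a j + connMat g c y j a * hTensor g y i a) := by
  simp only [hTensor]
  rw [pd_div c (hg.differentiableAt_of_contDiffOn hy (hg.contDiffOn_weylContr i j))
    (hg.differentiableAt_of_contDiffOn hy hg.contDiffOn_weylSq) h0, hg.pd_weylContr hy hrec,
    hg.pd_weylSq hy hrec]
  have h (a : Fin n) : connMat g c y i a * (weylContr g y a j / weylSq g y)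
      + connMat g c y j a * (weylContr g y i a / weylSq g y)
      = (connMat g c y i a * weylContr g y a j + connMat g c y j a * weylContr g y i a)
        / weylSq g y := by ring
  simp only [h, ← Finset.sum_div]
  field_simp
  ring

/-- The coordinate form of the theorem: a recurrent Weyl tensor with `C² ≠ 0` makes `h`
covariantly constant, Riemann and Weyl compatible, and commuting with the Ricci tensor. -/
theorem hTensor_properties (hg : IsSmoothMetricOn g U)
    (α : EuclideanSpace ℝ (Fin n) → Fin n → ℝ)
    (hrec : ∀ z ∈ U, ∀ i j k l m,
      covDeriv₄ g (weylLow g) z i j k l m = α z i * weylLow g z j k l m)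
    (h0 : ∀ z ∈ U, weylSq g z ≠ 0) (hy : y ∈ U) :
    IsCovConstAt g (hTensor g) y ∧ IsCompatible (riemann g y) (hTensor g y) ∧
      IsCompatible (weyl g y) (hTensor g y) ∧ CommutesWithRicciAt g (hTensor g y) y := by
  have hpd {z} (hz : z ∈ U) (c) := hg.pd_hTensor hz (h0 z hz) (hrec z hz c)
  have hsymm := hg.hTensor_symm hy
  -- The Ricci identity differentiates `∇h = 0` once more, so this equation is supplied on all of
  -- `U`, not only at `y`.
  have hann (j k : Fin n) := hg.curvMat_mul_add_mul_transpose_eq_zero hy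
    (b := fun z ↦ Matrix.of (hTensor g z)) (hg.contDiffOn_hTensor h0)
    (fun z hz c ↦ by
      ext i j
      simp only [pdMat, Matrix.of_apply, Matrix.add_apply, Matrix.mul_apply,
        Matrix.transpose_apply]
      rw [hpd hz, ← Finset.sum_add_distrib]
      exact Finset.sum_congr rfl fun a _ ↦ by ring) j k
  have hR : IsCompatible (riemann g y) (hTensor g y) := by
    refine hg.isCompatible_riemann hy fun i j k l ↦ ?_
    have h := congrFun₂ (hann j k) i l
    simp only [Matrix.add_apply, Matrix.mul_apply, Matrix.transpose_apply, Matrix.zero_apply,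
      curvMat, Matrix.of_apply] at h
    rw [eq_neg_iff_add_eq_zero, add_comm, ← h]
    congr 1
    exact Finset.sum_congr rfl fun m _ ↦ by rw [hsymm l m, mul_comm]
  have hcomm := hg.commutesWithRicciAt hy hsymm hR
  refine ⟨⟨fun i j ↦ hg.differentiableAt_of_contDiffOn hy (hg.contDiffOn_hTensor h0 i j),
    fun k i j ↦ ?_⟩, hR, isCompatible_weyl hsymm hR hcomm, hcomm⟩
  rw [covDeriv₂, hpd hy, sub_eq_zero]
  rfl

end IsSmoothMetricOn

end Recurrence

end Coord

/-! ### Components of a metric in a chart -/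

section ChartComponents

variable {n : ℕ} {M : Type*} [TopologicalSpace M] [ChartedSpace (EuclideanSpace ℝ (Fin n)) M]
  {e : OpenPartialHomeomorph M (EuclideanSpace ℝ (Fin n))}

lemma mdifferentiable_of_mem_maximalAtlas (he : e ∈ IsManifold.maximalAtlas (𝓡 n) ∞ M) :
    e.MDifferentiable (𝓡 n) (𝓡 n) :=
  ⟨(contMDiffOn_of_mem_maximalAtlas he).mdifferentiableOn (by simp),
    (contMDiffOn_symm_of_mem_maximalAtlas he).mdifferentiableOn (by simp)⟩

lemma mfderiv_symm_eq_sum_coordVector (y v : EuclideanSpace ℝ (Fin n)) :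
    mfderiv (𝓡 n) (𝓡 n) e.symm y v = ∑ i, v i • coordVector e i y := by
  conv_lhs => rw [← (EuclideanSpace.basisFun (Fin n) ℝ).sum_repr v]
  simp only [EuclideanSpace.basisFun_apply, EuclideanSpace.basisFun_repr]
  exact (map_sum _ _ _).trans (Finset.sum_congr rfl fun i _ ↦ map_smul _ _ _)

variable [IsManifold (𝓡 n) ∞ M]

/-- The field `∂_i` is the image of a constant section under the tangent map of `e.symm`. -/
lemma contMDiffOn_coordVector (he : e ∈ IsManifold.maximalAtlas (𝓡 n) ∞ M) (i : Fin n) :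
    ContMDiffOn (𝓡 n) ((𝓡 n).prod 𝓘(ℝ, EuclideanSpace ℝ (Fin n))) ∞
      (fun y ↦ Bundle.TotalSpace.mk' (E := fun x : M ↦ TangentSpace (𝓡 n) x)
        (EuclideanSpace ℝ (Fin n)) (e.symm y) (coordVector e i y)) e.target := by
  have h1 := (contMDiffOn_symm_of_mem_maximalAtlas he).contMDiffOn_tangentMapWithin (m := ∞)
    (by simp) e.open_target.uniqueMDiffOn
  have h2 : ContMDiffOn (𝓡 n) (𝓡 n).tangent ∞
      (fun y ↦ (⟨y, EuclideanSpace.single i (1 : ℝ)⟩ :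
        TangentBundle (𝓡 n) (EuclideanSpace ℝ (Fin n)))) e.target :=
    fun y _ ↦
    contMDiffWithinAt_vectorSpace_iff_contDiffWithinAt.2 contDiffWithinAt_const
  refine (h1.comp h2 fun y hy ↦ hy).congr fun y hy ↦ ?_
  simp only [Function.comp, tangentMapWithin, coordVector]
  rw [mfderivWithin_of_isOpen e.open_target hy]

lemma PseudoRiemannianMetric.contDiffOn_comp (g : PseudoRiemannianMetric n M)
    (he : e ∈ IsManifold.maximalAtlas (𝓡 n) ∞ M) (i j : Fin n) :
    ContDiffOn ℝ ∞ (fun y ↦ g.comp e y i j) e.target := by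
  have h1 := g.contMDiff.comp_contMDiffOn (contMDiffOn_symm_of_mem_maximalAtlas he)
  have h2 := ContMDiffOn.clm_bundle_apply₂ (E₃ := fun _ : M ↦ ℝ) (F₃ := ℝ) h1
    (contMDiffOn_coordVector he i) (contMDiffOn_coordVector he j)
  rw [← contMDiffOn_iff_contDiffOn]
  intro y hy
  exact (Bundle.contMDiffWithinAt_totalSpace.1 (h2 y hy)).2

/-- A null vector of the matrix is carried by the differential of `e.symm` to a vector orthogonal to
the whole tangent space, by surjectivity. Nondegeneracy makes the image zero, and injectivity the
null vector. -/
lemma PseudoRiemannianMetric.det_comp_ne_zero (g : PseudoRiemannianMetric n M)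
    (he : e ∈ IsManifold.maximalAtlas (𝓡 n) ∞ M) {y : EuclideanSpace ℝ (Fin n)}
    (hy : y ∈ e.target) : (g.comp e y).det ≠ 0 := by
  have hm := (mdifferentiable_of_mem_maximalAtlas he).symm
  intro h
  obtain ⟨v, hv, hv0⟩ := Matrix.exists_vecMul_eq_zero_iff.2 h
  apply hv
  set w : EuclideanSpace ℝ (Fin n) := WithLp.toLp 2 v
  have h1 (j : Fin n) : g.inner (e.symm y) (mfderiv (𝓡 n) (𝓡 n) e.symm y w)
      (coordVector e j y) = 0 := by
    rw [mfderiv_symm_eq_sum_coordVector, map_sum, sum_apply]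
    simp only [map_smul, smul_apply]
    exact congrFun hv0 j
  have h2 : mfderiv (𝓡 n) (𝓡 n) e.symm y w = 0 := by
    refine g.nondegenerate _ _ fun u ↦ ?_
    obtain ⟨u', rfl⟩ := hm.mfderiv_surjective hy u
    rw [mfderiv_symm_eq_sum_coordVector (e := e) y u', map_sum]
    refine Finset.sum_eq_zero fun j _ ↦ ?_
    rw [map_smul, h1, smul_zero]
  have h3 : w = 0 := hm.mfderiv_injective hy (h2.trans (map_zero _).symm)
  exact congrArg WithLp.ofLp h3

lemma PseudoRiemannianMetric.isSmoothMetricOn_comp (g : PseudoRiemannianMetric n M)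
    (he : e ∈ IsManifold.maximalAtlas (𝓡 n) ∞ M) :
    Coord.IsSmoothMetricOn (g.comp e) e.target where
  isOpen := e.open_target
  contDiffOn := g.contDiffOn_comp he
  isSymm _ _ := Matrix.ext fun _ _ ↦ g.symm _ _ _
  det_ne_zero _ hy := g.det_comp_ne_zero he hy

end ChartComponents

end

theorem mainTheorem5 (n : ℕ) (hn : 4 ≤ n) (M : Type*) [TopologicalSpace M] [T2Space M]
    [ConnectedSpace M] [ChartedSpace (EuclideanSpace ℝ (Fin n)) M] [IsManifold (𝓡 n) ∞ M]
    (g : PseudoRiemannianMetric n M) (hrec : g.IsConformallyRecurrent) (hC : g.WeylSqNeZero) :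
    ∀ e ∈ IsManifold.maximalAtlas (𝓡 n) ∞ M, ∀ y ∈ e.target,
      Coord.IsCovConstAt (g.comp e) (Coord.hTensor (g.comp e)) y ∧
      Coord.IsCompatible (Coord.riemann (g.comp e) y) (Coord.hTensor (g.comp e) y) ∧
      Coord.IsCompatible (Coord.weyl (g.comp e) y) (Coord.hTensor (g.comp e) y) ∧
      Coord.CommutesWithRicciAt (g.comp e) (Coord.hTensor (g.comp e) y) y := by
  intro e he y hy
  obtain ⟨α, -, hα⟩ := hrec
  exact (g.isSmoothMetricOn_comp he).hTensor_properties (α.comp e) (hα e he) (hC e he) hy
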